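/- Let $\mathcal O(\mathbb N^{\mathbb N})$ and $\mathcal A(\mathbb N^{\mathbb N})$ be the represented spaces of open and of closed subsets of Baire space: a name of an open set $U$ is a name of its characteristic function as a continuous function from $\mathbb N^{\mathbb N}$ into Sierpiński space, and the names of a closed set $A$ are those of the open set $\mathbb N^{\mathbb N}\setminus A$. In the Gale–Stewart game with winning condition $W\subseteq\mathbb N^{\mathbb N}$, Players 1 and 2 alternately choose natural numbers $x_0,x_1,x_2,\dots$, Player 1 moving first; Player 1 wins if $(x_n)_n\in W$, and Player 2 wins otherwise. Strategies, that is, functions from finite sequences of natural numbers to $\mathbb N$, are coded as elements of $\mathbb N^{\mathbb N}$. Let $\mathsf{FindWS}_{\boldsymbol\Pi}:\subseteq\mathcal O(\mathbb N^{\mathbb N})\rightrightarrows\mathbb N^{\mathbb N}$ be the multivalued function whose domain consists of the open sets $W$ for which Player 1 has no winning strategy, and which maps such a $W$ to any winning strategy of Player 2. Let $\mathsf C_{\mathbb N^{\mathbb N}}:\subseteq\mathcal A(\mathbb N^{\mathbb N})\rightrightarrows\mathbb N^{\mathbb N}$ be the multivalued function that maps a nonempty closed set $A$ to any element of $A$.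 Then $\mathsf{FindWS}_{\boldsymbol\Pi}\equiv_{\mathrm W}\mathsf C_{\mathbb N^{\mathbb N}}$, where $f\le_{\mathrm W}g$ means that there are computable $K,H:\subseteq\mathbb N^{\mathbb N}\to\mathbb N^{\mathbb N}$ such that $p\mapsto K\langle p,G(H(p))\rangle$ realizes $f$ for every realizer $G$ of $g$, and $f\equiv_{\mathrm W}g$ means $f\le_{\mathrm W}g$ and $g\le_{\mathrm W}f$. -/

import Mathlib

/-- Baire space `ℕ^ℕ`. -/
abbrev Baire : Type := ℕ → ℕ

/-- The finite initial segment `(x 0, …, x (n - 1))`. -/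
def initSeg (x : Baire) (n : ℕ) : List ℕ := (List.range n).map x

/-- The pairing `⟨p, q⟩` on Baire space: `p` on the even and `q` on the odd positions. -/
def bairePair (p q : Baire) : Baire := fun n => if n % 2 = 0 then p (n / 2) else q (n / 2)

/-! ### Computable partial functions on Baire space -/

/-- Partial recursive functionals with one function oracle: `Φ p n` is the outcome of one fixed
program on the input `n` with the oracle `p`. -/
inductive OracleRecursive : (Baire → ℕ →. ℕ) → Prop
  | zero : OracleRecursive fun _ _ => Part.some 0
  | succ : OracleRecursive fun _ n => Part.some (n + 1)
  | left : OracleRecursive fun _ n => Part.some (Nat.unpair n).1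
  | right : OracleRecursive fun _ n => Part.some (Nat.unpair n).2
  | oracle : OracleRecursive fun p n => Part.some (p n)
  | pair {Φ Ψ : Baire → ℕ →. ℕ} (hΦ : OracleRecursive Φ) (hΨ : OracleRecursive Ψ) :
      OracleRecursive fun p n => (Φ p n).bind fun a => (Ψ p n).map fun b => Nat.pair a b
  | comp {Φ Ψ : Baire → ℕ →. ℕ} (hΦ : OracleRecursive Φ) (hΨ : OracleRecursive Ψ) :
      OracleRecursive fun p n => (Ψ p n).bind (Φ p)
  | prec {Φ Ψ : Baire → ℕ →. ℕ} (hΦ : OracleRecursive Φ) (hΨ : OracleRecursive Ψ) :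
      OracleRecursive fun p n =>
        Nat.rec (motive := fun _ => Part ℕ) (Φ p (Nat.unpair n).1)
          (fun y ih => ih.bind fun i => Ψ p (Nat.pair (Nat.unpair n).1 (Nat.pair y i)))
          (Nat.unpair n).2
  | rfind {Φ : Baire → ℕ →. ℕ} (hΦ : OracleRecursive Φ) :
      OracleRecursive fun p n =>
        Nat.rfind fun m => (Φ p (Nat.pair n m)).map fun k => decide (k = 0)

/-- A partial function on Baire space is computable if one program with oracle `p` computes
`F p`, for all `p` in the domain of `F`. -/
def BaireComputable (F : Baire →. Baire) : Prop :=
  ∃ Φ : Baire → ℕ →. ℕ, OracleRecursive Φ ∧ ∀ p, ∀ q ∈ F p, ∀ n, q n ∈ Φ p n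

/-- A partial function on Baire space is continuous if it is so on its domain. -/
def BaireContinuous (F : Baire →. Baire) : Prop :=
  Continuous fun p : F.Dom => F.fn p.1 p.2

/-! ### Represented spaces -/

/-- A represented space. The partial surjection `δ` from Baire space is given by its graph:
`IsName p x` says that `p` is in the domain of `δ` and `δ p = x`. -/
structure RepSpace where
  carrier : Type
  IsName : Baire → carrier → Prop
  unique : ∀ {p x y}, IsName p x → IsName p y → x = y
  surj : ∀ x, ∃ p, IsName p x

/-- Baire space, represented by the identity. -/
def baireSpace : RepSpace where
  carrier := Baire
  IsName p x := p = x
  unique h h' := h.symm.trans h'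
  surj x := ⟨x, rfl⟩

/-- Sierpinski space: the only name of `⊥` is the zero sequence, all others name `⊤`. -/
def sierpinski : RepSpace where
  carrier := Prop
  IsName p b := b ↔ ∃ n, p n ≠ 0
  unique h h' := propext (h.trans h'.symm)
  surj b := by
    by_cases hb : b
    · exact ⟨fun _ => 1, by simp [hb]⟩
    · exact ⟨fun _ => 0, by simp [hb]⟩

/-- `F` realizes the (single-valued, total) function `f`. -/
def RealizesFun {X Y : RepSpace} (F : Baire →. Baire) (f : X.carrier → Y.carrier) : Prop :=
  ∀ p x, X.IsName p x → ∃ q ∈ F p, Y.IsName q (f x)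

/-- A function between represented spaces is continuous if it has a continuous realizer. -/
def RepContinuous {X Y : RepSpace} (f : X.carrier → Y.carrier) : Prop :=
  ∃ F : Baire →. Baire, BaireContinuous F ∧ RealizesFun F f

/-- The continuous partial function on Baire space coded by `α` (Kleene's second algebra): the
`n`-th value at `x` is `k` if the first nonzero term among `α ⟨n, (x 0, …, x (m - 1))⟩`,
`m = 0, 1, 2, …`, is `k + 1`. The value at `x` is defined if all its terms are. -/
def kleeneApp (α : Baire) : Baire →. Baire := fun x =>
  { Dom := ∀ n, ∃ m, α (Nat.pair n (Encodable.encode (initSeg x m))) ≠ 0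
    get := fun h n => α (Nat.pair n (Encodable.encode (initSeg x (Nat.find (h n))))) - 1 }

theorem initSeg_length (x : Baire) (n : ℕ) : (initSeg x n).length = n := by simp [initSeg]

theorem initSeg_eq_iff {x y : Baire} {n : ℕ} :
    initSeg x n = initSeg y n ↔ ∀ i < n, x i = y i := by
  simp [initSeg]

theorem initSeg_succ (x : Baire) (n : ℕ) : initSeg x (n + 1) = initSeg x n ++ [x n] := by
  simp [initSeg, List.range_succ]

/-- A neighbourhood of a point of Baire space contains a cylinder around that point. -/
theorem exists_cylinder {U : Set Baire} {x : Baire} (h : U ∈ nhds x) :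
    ∃ m, ∀ y, initSeg y m = initSeg x m → y ∈ U := by
  rw [nhds_pi, Filter.mem_pi] at h
  obtain ⟨I, hI, t, ht, hU⟩ := h
  obtain ⟨b, hb⟩ := hI.bddAbove
  refine ⟨b + 1, fun y hy => hU fun i hi => ?_⟩
  rw [initSeg_eq_iff.1 hy i (Nat.lt_succ_of_le (hb hi))]
  exact mem_of_mem_nhds (ht i)

/-- Every continuous partial function on Baire space is extended by one that has a code. -/
theorem exists_kleeneApp {F : Baire →. Baire} (hF : BaireContinuous F) :
    ∃ α, ∀ x, ∀ q ∈ F x, q ∈ kleeneApp α x := by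
  classical
  let good : ℕ → List ℕ → ℕ → Prop := fun n w k =>
    (∃ x q, q ∈ F x ∧ initSeg x w.length = w) ∧
      ∀ x q, q ∈ F x → initSeg x w.length = w → q n = k
  let α : Baire := fun c =>
    if h : ∃ k, good c.unpair.1 ((Encodable.decode (α := List ℕ) c.unpair.2).getD []) k
    then h.choose + 1 else 0
  have hα : ∀ n w k, α (Nat.pair n (Encodable.encode w)) = k + 1 → good n w k := by
    intro n w k h
    simp only [α] at h
    split_ifs at h with h'
    have h1 := h'.choose_spec
    have h2 : h'.choose = k := by omega
    rw [h2] at h1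
    simpa only [Nat.unpair_pair, Encodable.encodek, Option.getD_some] using h1
  have hα' : ∀ n w k, good n w k → α (Nat.pair n (Encodable.encode w)) ≠ 0 := by
    intro n w k h
    simp only [α]
    rw [dif_pos]
    · exact Nat.succ_ne_zero _
    · refine ⟨k, ?_⟩
      simpa only [Nat.unpair_pair, Encodable.encodek, Option.getD_some] using h
  refine ⟨α, fun x q hq => ?_⟩
  have hdom : ∀ n, ∃ m, α (Nat.pair n (Encodable.encode (initSeg x m))) ≠ 0 := by
    intro n
    have hx : x ∈ F.Dom := Part.dom_iff_mem.2 ⟨q, hq⟩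
    have hc : Continuous fun p : F.Dom => F.fn p.1 p.2 n := (continuous_apply n).comp hF
    have hn := hc.continuousAt.preimage_mem_nhds
      ((isOpen_discrete ({F.fn x hx n} : Set ℕ)).mem_nhds (x := F.fn x hx n) rfl)
      (x := ⟨x, hx⟩)
    rw [mem_nhds_subtype] at hn
    obtain ⟨U, hU, hUs⟩ := hn
    obtain ⟨m, hm⟩ := exists_cylinder hU
    refine ⟨m, hα' n _ (q n) ⟨⟨x, q, hq, by rw [initSeg_length]⟩, fun y r hr hy => ?_⟩⟩
    rw [initSeg_length] at hy
    have hyd : y ∈ F.Dom := Part.dom_iff_mem.2 ⟨r, hr⟩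
    have h1 : F.fn y hyd n = F.fn x hx n := hUs (a := ⟨y, hyd⟩) (hm y hy)
    have h2 : F.fn y hyd = r := Part.get_eq_of_mem hr hyd
    have h3 : F.fn x hx = q := Part.get_eq_of_mem hq hx
    rw [← h2, ← h3, h1]
  refine ⟨hdom, ?_⟩
  funext n
  have hs := Nat.find_spec (hdom n)
  obtain ⟨k, hk⟩ := Nat.exists_eq_succ_of_ne_zero hs
  have hg := (hα n _ k hk).2 x q hq (by rw [initSeg_length])
  change α _ - 1 = q n
  rw [hk, hg]
  rfl

/-- The space of continuous functions from `X` to `Y`: a name of `f` is a code of a realizer. -/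
def funSpace (X Y : RepSpace) : RepSpace where
  carrier := {f : X.carrier → Y.carrier // RepContinuous f}
  IsName α f := RealizesFun (kleeneApp α) f.1
  unique := by
    intro α f g hf hg
    apply Subtype.ext
    funext x
    obtain ⟨p, hp⟩ := X.surj x
    obtain ⟨q, hq, hqf⟩ := hf p x hp
    obtain ⟨r, hr, hrg⟩ := hg p x hp
    rw [Part.mem_unique hq hr] at hqf
    exact Y.unique hqf hrg
  surj := by
    rintro ⟨f, F, hF, hFf⟩
    obtain ⟨α, hα⟩ := exists_kleeneApp hF
    refine ⟨α, fun p x hp => ?_⟩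
    obtain ⟨q, hq, hqf⟩ := hFf p x hp
    exact ⟨q, hα p q hq, hqf⟩

/-- The space `𝒪(X)` of open subsets of `X`: a set is identified with its continuous
characteristic function into Sierpinski space. -/
def openSpace (X : RepSpace) : RepSpace := funSpace X sierpinski

/-- The set of points of an element of `𝒪(X)`. -/
def openSpace.toSet {X : RepSpace} (U : (openSpace X).carrier) : Set X.carrier := {x | U.1 x}

/-- The space `𝒜(X)` of closed subsets of `X`: the names of `A` are those of its complement
in `𝒪(X)`. -/
def closedSpace (X : RepSpace) : RepSpace where
  carrier := {A : Set X.carrier //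
    RepContinuous (X := X) (Y := sierpinski) fun x => x ∉ A}
  IsName p A := (openSpace X).IsName p ⟨fun x => x ∉ A.1, A.2⟩
  unique := by
    intro p A B hA hB
    have h := congrArg Subtype.val ((openSpace X).unique hA hB)
    apply Subtype.ext
    ext x
    exact not_iff_not.1 (iff_of_eq (congrFun h x))
  surj A := (openSpace X).surj _

/-! ### Multivalued functions and Weihrauch reducibility -/

/-- A partial multivalued function from `X` to `Y`. -/
structure MultiFun (X Y : RepSpace) where
  dom : Set X.carrier
  val : X.carrier → Set Y.carrier
  nonempty : ∀ x ∈ dom, (val x).Nonempty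

/-- `F` realizes the partial multivalued function `f`. -/
def Realizes {X Y : RepSpace} (F : Baire →. Baire) (f : MultiFun X Y) : Prop :=
  ∀ p x, X.IsName p x → x ∈ f.dom → ∃ q ∈ F p, ∃ y ∈ f.val x, Y.IsName q y

/-- Weihrauch reducibility: there are computable `K`, `H` such that `p ↦ K ⟨p, G (H p)⟩` realizes
`f` for every realizer `G` of `g`. -/
def WeihrauchLE {X Y Z W : RepSpace} (f : MultiFun X Y) (g : MultiFun Z W) : Prop :=
  ∃ K H : Baire →. Baire, BaireComputable K ∧ BaireComputable H ∧
    ∀ G : Baire →. Baire, Realizes G g →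
      Realizes (fun p => (H p).bind fun a => (G a).bind fun b => K (bairePair p b)) f

/-- Weihrauch equivalence. -/
def WeihrauchEquiv {X Y Z W : RepSpace} (f : MultiFun X Y) (g : MultiFun Z W) : Prop :=
  WeihrauchLE f g ∧ WeihrauchLE g f

/-- Closed choice on `X`: given a nonempty closed set, find one of its points. -/
def closedChoice (X : RepSpace) : MultiFun (closedSpace X) X where
  dom := {A | A.1.Nonempty}
  val A := A.1
  nonempty _ h := h

/-! ### Gale-Stewart games

The players alternately choose natural numbers, Player 1 choosing `x 0, x 2, …` and Player 2
choosing `x 1, x 3, …`. Player 1 wins the play `x` if `x ∈ W`, otherwise Player 2 wins. A strategy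
is a point of Baire space: its value at the code of a position is the move to make there. -/

/-- Player 1 follows the strategy `σ` in the play `x`. -/
def Follows1 (σ x : Baire) : Prop :=
  ∀ n, x (2 * n) = σ (Encodable.encode (initSeg x (2 * n)))

/-- Player 2 follows the strategy `τ` in the play `x`. -/
def Follows2 (τ x : Baire) : Prop :=
  ∀ n, x (2 * n + 1) = τ (Encodable.encode (initSeg x (2 * n + 1)))

/-- `σ` is a winning strategy for Player 1 in the game `W`. -/
def Wins1 (W : Set Baire) (σ : Baire) : Prop := ∀ x, Follows1 σ x → x ∈ W

/-- `τ` is a winning strategy for Player 2 in the game `W`. -/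
def Wins2 (W : Set Baire) (τ : Baire) : Prop := ∀ x, Follows2 τ x → x ∉ W

theorem isOpen_toSet (U : (openSpace baireSpace).carrier) :
    IsOpen (show Set Baire from openSpace.toSet U) := by
  obtain ⟨f, F, hF, hFf⟩ := U
  have hd : ∀ x, x ∈ F.Dom := fun x => by
    obtain ⟨q, hq, -⟩ := hFf x x rfl
    exact Part.dom_iff_mem.2 ⟨q, hq⟩
  have hc : Continuous fun x : Baire => F.fn x (hd x) :=
    hF.comp (continuous_id.subtype_mk hd)
  have ho : IsOpen {q : Baire | ∃ n, q n ≠ 0} := by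
    have : {q : Baire | ∃ n, q n ≠ 0} = ⋃ n, (fun q : Baire => q n) ⁻¹' {k : ℕ | k ≠ 0} := by
      ext q
      simp
    rw [this]
    exact isOpen_iUnion fun n => (isOpen_discrete _).preimage (continuous_apply n)
  have he : (show Set Baire from openSpace.toSet ⟨f, F, hF, hFf⟩) =
      (fun x : Baire => F.fn x (hd x)) ⁻¹' {q : Baire | ∃ n, q n ≠ 0} := by
    ext x
    obtain ⟨q, hq, hqf⟩ := hFf x x rfl
    have h2 : F.fn x (hd x) = q := Part.get_eq_of_mem hq (hd x)
    change f x ↔ ∃ n, F.fn x (hd x) n ≠ 0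
    rw [h2]
    exact hqf
  rw [he]
  exact ho.preimage hc

/-- Open games are determined. -/
theorem open_determinacy {W : Set Baire} (hW : IsOpen W) (h1 : ¬ ∃ σ, Wins1 W σ) :
    ∃ τ, Wins2 W τ := by
  classical
  -- `Q u`: Player 1 has a strategy that wins from the position `u` on.
  let Q : List ℕ → Prop := fun u => ∃ σ : Baire, ∀ x : Baire, initSeg x u.length = u →
    (∀ n, u.length ≤ 2 * n → x (2 * n) = σ (Encodable.encode (initSeg x (2 * n)))) → x ∈ W
  have hQ0 : ¬ Q [] := by
    rintro ⟨σ, hσ⟩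
    exact h1 ⟨σ, fun x hx => hσ x rfl fun n _ => hx n⟩
  have hQeven : ∀ (u : List ℕ) (a : ℕ), u.length % 2 = 0 → Q (u ++ [a]) → Q u := by
    rintro u a hu ⟨σ, hσ⟩
    refine ⟨Function.update σ (Encodable.encode u) a, fun x hxu hx => ?_⟩
    have ha : x u.length = a := by
      have h2 : 2 * (u.length / 2) = u.length := by omega
      have := hx (u.length / 2) (by omega)
      rw [h2, hxu] at this
      simpa using this
    refine hσ x (by simp [initSeg_succ, hxu, ha]) fun n hn => ?_
    rw [List.length_append, List.length_singleton] at hn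
    rw [hx n (by omega), Function.update_of_ne]
    intro he
    have := congrArg List.length (Encodable.encode_injective he)
    rw [initSeg_length] at this
    omega
  have hQodd : ∀ u : List ℕ, u.length % 2 = 1 → (∀ a, Q (u ++ [a])) → Q u := by
    intro u hu h
    choose σ hσ using h
    refine ⟨fun c => σ (((Encodable.decode (α := List ℕ) c).getD []).getD u.length 0) c,
      fun x hxu hx => ?_⟩
    refine hσ (x u.length) x (by simp [initSeg_succ, hxu]) fun n hn => ?_
    rw [List.length_append, List.length_singleton] at hn
    rw [hx n (by omega)]
    have hlt : u.length < 2 * n := by omega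
    simp [initSeg, hlt]
  refine ⟨fun c => if h : ∃ a, ¬ Q ((Encodable.decode (α := List ℕ) c).getD [] ++ [a])
    then h.choose else 0, fun x hx hxW => ?_⟩
  have hn : ∀ n, ¬ Q (initSeg x n) := by
    intro n
    induction n with
    | zero => exact hQ0
    | succ n ih =>
      rw [initSeg_succ]
      rcases Nat.mod_two_eq_zero_or_one n with h0 | h0
      · exact fun h => ih (hQeven _ _ (by rw [initSeg_length]; exact h0) h)
      · have hex : ∃ a, ¬ Q (initSeg x n ++ [a]) := by
          by_contra! hcon
          exact ih (hQodd _ (by rw [initSeg_length]; exact h0) hcon)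
        have h2 : 2 * (n / 2) + 1 = n := by omega
        have hm := hx (n / 2)
        rw [h2] at hm
        simp only [Encodable.encodek, Option.getD_some] at hm
        rw [dif_pos hex] at hm
        rw [hm]
        exact hex.choose_spec
  obtain ⟨m, hm⟩ := exists_cylinder (hW.mem_nhds hxW)
  exact hn m ⟨x, fun y hy _ => hm y (by rwa [initSeg_length] at hy)⟩

/-- Given an open game in which Player 1 has no winning strategy, find a winning strategy for
Player 2. -/
def FindWSPi : MultiFun (openSpace baireSpace) baireSpace where
  dom := {W | ¬ ∃ σ, Wins1 (openSpace.toSet W) σ}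
  val W := {τ | Wins2 (openSpace.toSet W) τ}
  nonempty W h := open_determinacy (isOpen_toSet W) h

/-! Both reductions use total computable maps, so no partial recursion beyond `OracleRecursive` with
total values is needed.

From closed choice to games: for a nonempty closed set `A`, let Player 2 win exactly when the
sequence of his own moves lies in `A`. This game is open, and Player 1 has no winning strategy,
since Player 2 can play a fixed point of `A` move by move (`exists_follows1_oddPart`). A winning
strategy of Player 2, run against an opponent who plays only zeros, produces a point of `A`
(`replies`).

From games to closed choice: the winning strategies of Player 2 in an open game `W` form a closed
set, nonempty by `open_determinacy`. Indeed `τ` loses iff some finite position consistent with `τ`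
already guarantees membership in `W` (`not_wins2_iff`). Such a position `w` can be checked on finite
parts of `τ` and of the code of `W`, because the codes of the prefixes of `w` are bounded by the
code of `w` (`encode_take_le`). Hence a name of the closed set is computable from a name of `W`
(`realizesFun_losingCode`), and choice on it returns the strategy. -/

/-! ### Total functionals computable with an oracle -/

/-- A total functional is computable if some program with an oracle computes it. -/
def OracleComputable (f : Baire → ℕ → ℕ) : Prop :=
  OracleRecursive fun p n => Part.some (f p n)

namespace OracleComputable

theorem of_eq {f g : Baire → ℕ → ℕ} (hf : OracleComputable f) (h : ∀ p n, f p n = g p n) :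
    OracleComputable g :=
  (funext₂ h : f = g) ▸ hf

theorem oracle : OracleComputable fun p n => p n := OracleRecursive.oracle

theorem comp {f g : Baire → ℕ → ℕ} (hf : OracleComputable f) (hg : OracleComputable g) :
    OracleComputable fun p n => f p (g p n) := by
  have h := OracleRecursive.comp hf hg
  unfold OracleComputable
  simpa only [Part.bind_some] using h

theorem pair {f g : Baire → ℕ → ℕ} (hf : OracleComputable f) (hg : OracleComputable g) :
    OracleComputable fun p n => Nat.pair (f p n) (g p n) := by
  have h := OracleRecursive.pair hf hg
  unfold OracleComputable
  simpa only [Part.bind_some, Part.map_some] using h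

theorem prec {f g : Baire → ℕ → ℕ} (hf : OracleComputable f) (hg : OracleComputable g) :
    OracleComputable fun p n => Nat.rec (motive := fun _ => ℕ) (f p n.unpair.1)
      (fun y ih => g p (Nat.pair n.unpair.1 (Nat.pair y ih))) n.unpair.2 := by
  have h := OracleRecursive.prec hf hg
  unfold OracleComputable
  refine (congrArg OracleRecursive (funext₂ fun p n => ?_)).mpr h
  beta_reduce
  induction n.unpair.2 with
  | zero => rfl
  | succ y ih => simp only [← ih, Part.bind_some]

theorem of_natPrimrec {f : ℕ → ℕ} (hf : Nat.Primrec f) : OracleComputable fun _ n => f n := by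
  induction hf with
  | zero => exact OracleRecursive.zero
  | succ => exact OracleRecursive.succ
  | left => exact OracleRecursive.left
  | right => exact OracleRecursive.right
  | pair _ _ hf hg => exact hf.pair hg
  | comp _ _ hf hg => exact hf.comp hg
  | prec _ _ hf hg => exact hf.prec hg

theorem of_primrec {f : ℕ → ℕ} (hf : Primrec f) : OracleComputable fun _ n => f n :=
  of_natPrimrec (Primrec.nat_iff.1 hf)

/-- A primitive recursive function may be applied to two computed values. -/
theorem primrec₂ {g : ℕ → ℕ → ℕ} (hg : Primrec₂ g) {f₁ f₂ : Baire → ℕ → ℕ}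
    (h₁ : OracleComputable f₁) (h₂ : OracleComputable f₂) :
    OracleComputable fun p n => g (f₁ p n) (f₂ p n) := by
  have hg' : Primrec fun c : ℕ => g c.unpair.1 c.unpair.2 :=
    hg.comp (Primrec.fst.comp Primrec.unpair) (Primrec.snd.comp Primrec.unpair)
  exact ((of_primrec hg').comp (h₁.pair h₂)).of_eq fun p n => by simp only [Nat.unpair_pair]

theorem baireComputable {f : Baire → ℕ → ℕ} (hf : OracleComputable f) :
    BaireComputable fun p => Part.some (f p) :=
  ⟨_, hf, fun p q hq n => by rw [Part.mem_some_iff.1 hq]; exact Part.mem_some _⟩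

end OracleComputable

/-- The list with a given code. -/
def listOfCode (c : ℕ) : List ℕ := (Encodable.decode (α := List ℕ) c).getD []

@[simp]
theorem listOfCode_encode (u : List ℕ) : listOfCode (Encodable.encode u) = u := by
  simp [listOfCode]

@[simp]
theorem encode_listOfCode (c : ℕ) : Encodable.encode (listOfCode c) = c := by
  simp [listOfCode, Denumerable.decode_eq_ofNat]

theorem primrec_listOfCode : Primrec listOfCode :=
  Primrec.option_getD.comp Primrec.decode (Primrec.const _)

/-! ### Plays determined by a rule -/

/-- The position reached after `n` moves if the rule `f` makes all moves. -/
def playSeg (f : List ℕ → ℕ) : ℕ → List ℕ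
  | 0 => []
  | n + 1 => playSeg f n ++ [f (playSeg f n)]

/-- The play in which the rule `f` makes all moves. -/
def play (f : List ℕ → ℕ) : Baire := fun n => f (playSeg f n)

theorem initSeg_play (f : List ℕ → ℕ) (n : ℕ) : initSeg (play f) n = playSeg f n := by
  induction n with
  | zero => rfl
  | succ n ih => rw [initSeg_succ, ih]; rfl

theorem play_apply (f : List ℕ → ℕ) (n : ℕ) : play f n = f (initSeg (play f) n) := by
  rw [initSeg_play]; rfl

theorem OracleComputable.playSeg {f : Baire → List ℕ → ℕ}
    (hf : OracleComputable fun p c => f p (listOfCode c)) :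
    OracleComputable fun p n => Encodable.encode (playSeg (f p) n) := by
  -- In the argument `⟨a, ⟨y, ih⟩⟩` of the recursion step, this is the previous value `ih`.
  have hlast : Primrec fun c : ℕ => c.unpair.2.unpair.2 :=
    Primrec.snd.comp (Primrec.unpair.comp (Primrec.snd.comp Primrec.unpair))
  have hsnoc : Primrec₂ fun c a : ℕ => Encodable.encode (listOfCode c ++ [a]) :=
    Primrec.encode.comp₂ (Primrec.list_concat.comp₂
      (primrec_listOfCode.comp₂ Primrec₂.left) Primrec₂.right)
  have hstep := primrec₂ hsnoc (of_primrec hlast) (hf.comp (of_primrec hlast))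
  -- The recursion needs no parameter; 0 is a dummy.
  have harg : Primrec fun n : ℕ => Nat.pair 0 n := Primrec₂.natPair.comp (Primrec.const _) .id
  refine (((of_primrec (Primrec.const (Encodable.encode ([] : List ℕ)))).prec hstep).comp
    (of_primrec harg)).of_eq fun p n => ?_
  simp only [Nat.unpair_pair]
  induction n with
  | zero => rfl
  | succ n ih => simp only [ih, listOfCode_encode]; rfl

/-- The oracle `p` is itself the play of the rule `u ↦ p u.length`. -/
theorem OracleComputable.initSeg : OracleComputable fun p n => Encodable.encode (initSeg p n) := by
  have hlen : Primrec fun c : ℕ => (listOfCode c).length :=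
    Primrec.list_length.comp primrec_listOfCode
  have h : OracleComputable fun p c => p (listOfCode c).length := oracle.comp (of_primrec hlen)
  refine (OracleComputable.playSeg (f := fun p u => p u.length) h).of_eq fun p n => ?_
  have hp : play (fun u => p u.length) = p := by
    funext n
    rw [play_apply, initSeg_length]
  rw [← initSeg_play, hp]

/-- Replaces the oracle by a finite list, so that computability follows from primitive recursiveness
on lists. -/
theorem OracleComputable.of_initSeg {g : List ℕ → ℕ → ℕ} (hg : Primrec₂ g) :
    OracleComputable fun p n => g (_root_.initSeg p (n + 1)) n := by
  have hg' : Primrec₂ fun c n : ℕ => g (listOfCode c) n :=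
    hg.comp₂ (primrec_listOfCode.comp₂ Primrec₂.left) Primrec₂.right
  exact (primrec₂ hg' (initSeg.comp (of_primrec Primrec.succ))
    (of_primrec Primrec.id)).of_eq fun p n => by simp

/-! ### Codes of continuous functions -/

/-- The search for the `n`-th value stops at a finite `m`, and every point of the domain that agrees
with `x` below `m` yields the same search. It is needed to exhibit the sets below as points of
`openSpace` and `closedSpace`. -/
theorem kleeneApp_continuous (α : Baire) : BaireContinuous (kleeneApp α) := by
  refine continuous_pi fun n => continuous_iff_continuousAt.2 fun x => ?_
  have hx := Nat.find_spec (x.2 n)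
  have hmin := fun k => Nat.find_min (x.2 n) (m := k)
  set m := Nat.find (x.2 n) with hm
  have hU : IsOpen {y : Baire | ∀ i ∈ Finset.range m, y i = x.1 i} := by
    simp only [Set.ofPred_forall]
    exact isOpen_biInter_finset fun i _ =>
      (isOpen_discrete {k : ℕ | k = x.1 i}).preimage (continuous_apply (A := fun _ => ℕ) i)
  have hnhds : ∀ᶠ y : (kleeneApp α).Dom in nhds x, ∀ i ∈ Finset.range m, y.1 i = x.1 i :=
    continuous_subtype_val.continuousAt.eventually (hU.mem_nhds fun _ _ => rfl)
  refine Filter.Tendsto.congr' ?_ tendsto_const_nhds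
  filter_upwards [hnhds] with y hy
  have hseg : ∀ k ≤ m, initSeg y.1 k = initSeg x.1 k := fun k hk =>
    initSeg_eq_iff.2 fun i hi => hy i (Finset.mem_range.2 (by omega))
  have hfind : Nat.find (y.2 n) = m := by
    rw [Nat.find_eq_iff]
    refine ⟨by rw [hseg m le_rfl]; exact hx, fun k hk => ?_⟩
    rw [hseg k hk.le]
    exact hmin k hk
  change α _ - 1 = α _ - 1
  rw [hfind, hseg m le_rfl]

theorem take_initSeg (x : Baire) {i m : ℕ} (h : i ≤ m) : (initSeg x m).take i = initSeg x i := by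
  simp [initSeg, ← List.map_take, List.take_range, min_eq_left h]

theorem getD_initSeg (x : Baire) {i m : ℕ} (h : i < m) : (initSeg x m).getD i 0 = x i := by
  simp [initSeg, h]

/-- The code `α` prescribes a nonzero `n`-th value after reading exactly the list `w`. -/
def Detects (α : Baire) (n : ℕ) (w : List ℕ) : Prop :=
  2 ≤ α (Nat.pair n (Encodable.encode w)) ∧
    ∀ i < w.length, α (Nat.pair n (Encodable.encode (w.take i))) = 0

/-- An entry `k + 1` codes the value `k`, so a nonzero value means an entry of at least 2; the zeros
on shorter prefixes say that the search stops exactly there. -/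
theorem kleeneApp_ne_zero_iff {α x q : Baire} (hq : q ∈ kleeneApp α x) (n : ℕ) :
    q n ≠ 0 ↔ ∃ m, Detects α n (initSeg x m) := by
  obtain ⟨h, rfl⟩ := hq
  change α (Nat.pair n (Encodable.encode (initSeg x (Nat.find (h n))))) - 1 ≠ 0 ↔ _
  constructor
  · intro hne
    refine ⟨Nat.find (h n), by omega, fun i hi => ?_⟩
    rw [initSeg_length] at hi
    rw [take_initSeg x hi.le]
    exact not_not.1 (Nat.find_min (h n) hi)
  · rintro ⟨m, h2, h0⟩
    have hm : Nat.find (h n) = m := by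
      rw [Nat.find_eq_iff]
      refine ⟨by omega, fun k hk => not_not.2 ?_⟩
      have := h0 k (by rwa [initSeg_length])
      rwa [take_initSeg x hk.le] at this
    rw [hm]
    omega

/-- An open set is the union of the cylinders of the lists its code detects; this turns questions
about plays into questions about positions. -/
theorem mem_iff_exists_detects {α : Baire} {f : Baire → Prop}
    (hα : RealizesFun (X := baireSpace) (Y := sierpinski) (kleeneApp α) f) (x : Baire) :
    f x ↔ ∃ n m, Detects α n (initSeg x m) := by
  obtain ⟨q, hq, hqf⟩ := hα x x rfl
  have hqf : f x ↔ ∃ n, q n ≠ 0 := hqf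
  rw [hqf]
  exact exists_congr fun n => kleeneApp_ne_zero_iff hq n

/-! ### Closed choice is reducible to open games -/

/-- The moves of Player 2 in the play `x`. -/
def oddPart (x : Baire) : Baire := fun n => x (2 * n + 1)

/-- The moves of Player 2 in the position `v`. -/
def oddList (v : List ℕ) : List ℕ := (List.range (v.length / 2)).map fun i => v.getD (2 * i + 1) 0

theorem oddList_initSeg (x : Baire) (m : ℕ) :
    oddList (initSeg x m) = initSeg (oddPart x) (m / 2) := by
  rw [oddList, initSeg_length, initSeg]
  refine List.map_congr_left fun i hi => ?_
  rw [List.mem_range] at hi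
  exact getD_initSeg x (by omega)

theorem primrec_oddList : Primrec oddList := by
  refine Primrec.list_map (Primrec.list_range.comp
    (Primrec.nat_div.comp Primrec.list_length (Primrec.const 2))) ?_
  exact (Primrec.list_getD 0).comp₂ Primrec₂.left
    (Primrec.succ.comp₂ (Primrec.nat_mul.comp₂ (Primrec₂.const 2) Primrec₂.right))

/-- A code of `x ↦ kleeneApp α (oddPart x)`. -/
def oddPartCode (α : Baire) : Baire := fun c =>
  α (Nat.pair c.unpair.1 (Encodable.encode (oddList (listOfCode c.unpair.2))))

theorem oracleComputable_oddPartCode : OracleComputable oddPartCode :=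
  OracleComputable.oracle.comp (OracleComputable.of_primrec
    (Primrec₂.natPair.comp (Primrec.fst.comp Primrec.unpair)
      (Primrec.encode.comp (primrec_oddList.comp
        (primrec_listOfCode.comp (Primrec.snd.comp Primrec.unpair))))))

theorem mem_kleeneApp_oddPartCode {α x q : Baire} (hq : q ∈ kleeneApp α (oddPart x)) :
    q ∈ kleeneApp (oddPartCode α) x := by
  obtain ⟨h, rfl⟩ := hq
  have hcode : ∀ n m, oddPartCode α (Nat.pair n (Encodable.encode (initSeg x m))) =
      α (Nat.pair n (Encodable.encode (initSeg (oddPart x) (m / 2)))) := fun n m => by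
    simp only [oddPartCode, Nat.unpair_pair, listOfCode_encode, oddList_initSeg]
  have hdiv : ∀ m, 2 * m / 2 = m := fun m => by omega
  have h' : ∀ n, ∃ m, oddPartCode α (Nat.pair n (Encodable.encode (initSeg x m))) ≠ 0 := fun n => by
    obtain ⟨m, hm⟩ := h n
    exact ⟨2 * m, by rwa [hcode, hdiv]⟩
  refine ⟨h', funext fun n => ?_⟩
  -- Lengths `2 * j` and `2 * j + 1` both consult `α` at length `j`, so the first nonzero entry
  -- occurs at the even length.
  have hfind : Nat.find (h' n) = 2 * Nat.find (h n) := by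
    rw [Nat.find_eq_iff]
    refine ⟨by rw [hcode, hdiv]; exact Nat.find_spec (h n), fun k hk => ?_⟩
    rw [hcode]
    exact Nat.find_min (h n) (by omega)
  change oddPartCode α (Nat.pair n (Encodable.encode (initSeg x (Nat.find (h' n))))) - 1 =
    α (Nat.pair n (Encodable.encode (initSeg (oddPart x) (Nat.find (h n))))) - 1
  rw [hfind, hcode, hdiv]

theorem realizesFun_oddPartCode {α : Baire} {f : Baire → Prop}
    (hα : RealizesFun (X := baireSpace) (Y := sierpinski) (kleeneApp α) f) :
    RealizesFun (X := baireSpace) (Y := sierpinski) (kleeneApp (oddPartCode α))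
      fun x => f (oddPart x) := by
  rintro p x rfl
  obtain ⟨q, hq, hqf⟩ := hα (oddPart p) (oddPart p) rfl
  exact ⟨q, mem_kleeneApp_oddPartCode hq, hqf⟩

/-- Player 1 plays zeros and Player 2 follows the strategy that `r` carries on the odd positions. -/
def replyRule (r : Baire) (u : List ℕ) : ℕ :=
  if u.length % 2 = 1 then r (2 * Encodable.encode u + 1) else 0

/-- The moves that the strategy carried by `r` on the odd positions makes against zeros. -/
def replies (r : Baire) : Baire := oddPart (play (replyRule r))

theorem oracleComputable_replies : OracleComputable replies := by
  have hrule : OracleComputable fun p c => replyRule p (listOfCode c) := by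
    have hval : Primrec₂ fun c a : ℕ => if (listOfCode c).length % 2 = 1 then a else 0 :=
      Primrec.ite (Primrec.eq.comp (Primrec.nat_mod.comp (Primrec.list_length.comp
        (primrec_listOfCode.comp Primrec.fst)) (Primrec.const 2)) (Primrec.const 1))
        Primrec.snd (Primrec.const 0)
    have harg : Primrec fun c : ℕ => 2 * c + 1 :=
      Primrec.succ.comp (Primrec.nat_mul.comp (Primrec.const 2) Primrec.id)
    exact (OracleComputable.primrec₂ hval (.of_primrec Primrec.id)
      (OracleComputable.oracle.comp (.of_primrec harg))).of_eq fun p c => by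
        simp only [replyRule, encode_listOfCode, id]
  have harg : Primrec fun n : ℕ => 2 * n + 1 :=
    Primrec.succ.comp (Primrec.nat_mul.comp (Primrec.const 2) Primrec.id)
  refine (hrule.comp ((OracleComputable.playSeg hrule).comp (.of_primrec harg))).of_eq
    fun p n => ?_
  simp only [listOfCode_encode]
  rfl

theorem bairePair_odd (p q : Baire) (n : ℕ) : bairePair p q (2 * n + 1) = q n := by
  have h1 : (2 * n + 1) % 2 ≠ 0 := by omega
  have h2 : (2 * n + 1) / 2 = n := by omega
  simp only [bairePair, if_neg h1, h2]

theorem follows2_play_replyRule (p τ : Baire) : Follows2 τ (play (replyRule (bairePair p τ))) := by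
  intro n
  rw [play_apply, replyRule, initSeg_length, if_pos (by omega), bairePair_odd]

/-- The moves of Player 2 may be prescribed in advance. -/
theorem exists_follows1_oddPart (σ a : Baire) : ∃ x, Follows1 σ x ∧ oddPart x = a := by
  refine ⟨play fun u => if u.length % 2 = 0 then σ (Encodable.encode u) else a (u.length / 2),
    fun n => ?_, funext fun n => ?_⟩
  · rw [play_apply, initSeg_length, if_pos (by omega)]
  · rw [oddPart, play_apply, initSeg_length, if_neg (by omega)]
    congr 1
    omega

theorem closedChoice_le_findWSPi : WeihrauchLE (closedChoice baireSpace) FindWSPi := by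
  refine ⟨fun r => Part.some (replies r), fun p => Part.some (oddPartCode p),
    oracleComputable_replies.baireComputable, oracleComputable_oddPartCode.baireComputable,
    fun G hG p A hA hne => ?_⟩
  have hp : RealizesFun (X := baireSpace) (Y := sierpinski) (kleeneApp p) fun x => x ∉ A.1 := hA
  have hβ := realizesFun_oddPartCode hp
  let W : (openSpace baireSpace).carrier :=
    ⟨fun x => oddPart x ∉ A.1, kleeneApp (oddPartCode p), kleeneApp_continuous _, hβ⟩
  -- Against any `σ`, Player 2 can play a point `a` of `A`, and the resulting play lies outside `W`.
  have hW : W ∈ FindWSPi.dom := by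
    rintro ⟨σ, hσ⟩
    obtain ⟨a, ha⟩ := hne
    obtain ⟨x, hx, rfl⟩ := exists_follows1_oddPart σ a
    exact hσ x hx ha
  obtain ⟨τ, hτG, y, hy, rfl⟩ := hG (oddPartCode p) W hβ hW
  refine ⟨replies (bairePair p τ), ?_, replies (bairePair p τ), ?_, rfl⟩
  · simp only [Part.bind_some, Part.mem_bind_iff, Part.mem_some_iff]
    exact ⟨τ, hτG, rfl⟩
  · exact not_not.1 (hy _ (follows2_play_replyRule p τ))

/-! ### Open games are reducible to closed choice -/

theorem pair_right_monotone (a : ℕ) : Monotone (Nat.pair a) :=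
  StrictMono.monotone fun _ _ => Nat.pair_lt_pair_right a

/-- Bounds how much of `τ` and of `α` has to be read in order to test a position `w` together with
all its prefixes. -/
theorem encode_take_le (w : List ℕ) (i : ℕ) :
    Encodable.encode (w.take i) ≤ Encodable.encode w := by
  induction w generalizing i with
  | nil => simp
  | cons a w ih =>
    cases i with
    | zero => simp
    | succ i =>
      rw [List.take_succ_cons, Encodable.encode_list_cons, Encodable.encode_list_cons]
      exact Nat.succ_le_succ (pair_right_monotone _ (ih i))

/-- The position `w` is consistent with the strategy `τ` of Player 2. -/
def FollowsUpTo (τ : Baire) (w : List ℕ) : Prop :=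
  ∀ i < w.length, i % 2 = 1 → w.getD i 0 = τ (Encodable.encode (w.take i))

theorem Follows2.followsUpTo {τ x : Baire} (h : Follows2 τ x) (m : ℕ) :
    FollowsUpTo τ (initSeg x m) := by
  intro i hi hodd
  rw [initSeg_length] at hi
  have h2 : 2 * (i / 2) + 1 = i := by omega
  have := h (i / 2)
  rw [h2] at this
  rw [getD_initSeg x hi, take_initSeg x hi.le, this]

/-- Play out `w`, then let Player 2 follow `τ` against zeros. Thus a consistent position always
belongs to an actual play. -/
theorem FollowsUpTo.exists_follows2 {τ : Baire} {w : List ℕ} (h : FollowsUpTo τ w) :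
    ∃ x, Follows2 τ x ∧ initSeg x w.length = w := by
  let f : List ℕ → ℕ := fun u =>
    if u.length < w.length then w.getD u.length 0
    else if u.length % 2 = 1 then τ (Encodable.encode u) else 0
  have hw : ∀ i < w.length, play f i = w.getD i 0 := fun i hi => by
    rw [play_apply]
    simp only [f, initSeg_length, if_pos hi]
  have hseg : ∀ m ≤ w.length, initSeg (play f) m = w.take m := fun m hm => by
    refine List.ext_getElem (by simp [initSeg_length, hm]) fun i h₁ h₂ => ?_
    rw [initSeg_length] at h₁
    have hi : i < w.length := by omega
    simp [initSeg, hw i hi, hi]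
  refine ⟨play f, fun n => ?_, by rw [hseg _ le_rfl, List.take_length]⟩
  by_cases hn : 2 * n + 1 < w.length
  · rw [hw _ hn, hseg _ hn.le, h _ hn (by omega)]
  · rw [play_apply]
    simp only [f, initSeg_length, if_neg hn]
    rw [if_pos (by omega)]

/-- The strategies of Player 2 that win the game `W` form a closed set: `τ` fails exactly if some
position consistent with `τ` is recognized by a code of `W`. -/
theorem not_wins2_iff {α : Baire} {f : Baire → Prop}
    (hα : RealizesFun (X := baireSpace) (Y := sierpinski) (kleeneApp α) f) (τ : Baire) :
    ¬ Wins2 {x | f x} τ ↔ ∃ n w, FollowsUpTo τ w ∧ Detects α n w := by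
  simp only [Wins2, not_forall, not_not, exists_prop]
  constructor
  · rintro ⟨x, hx, hfx⟩
    obtain ⟨n, m, hd⟩ := (mem_iff_exists_detects hα x).1 hfx
    exact ⟨n, _, hx.followsUpTo m, hd⟩
  · rintro ⟨n, w, hw, hd⟩
    obtain ⟨x, hx, hxw⟩ := hw.exists_follows2
    exact ⟨x, hx, (mem_iff_exists_detects hα x).2 ⟨n, w.length, by rwa [hxw]⟩⟩

/-- With `l` and `v` for initial segments of `α` and `τ`: the position `w` is consistent with `τ`,
and `α` prescribes a nonzero `n`-th value after reading `w`. -/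
def RefutedBy (l v : List ℕ) (n : ℕ) (w : List ℕ) : Prop :=
  2 ≤ l.getD (Nat.pair n (Encodable.encode w)) 0 ∧
    ∀ i < w.length, l.getD (Nat.pair n (Encodable.encode (w.take i))) 0 = 0 ∧
      (i % 2 = 1 → w.getD i 0 = v.getD (Encodable.encode (w.take i)) 0)

instance (l v : List ℕ) (n : ℕ) (w : List ℕ) : Decidable (RefutedBy l v n w) := by
  unfold RefutedBy
  infer_instance

/-- The two bounds ensure that no lookup in the initial segments falls back on the default value 0.
-/
theorem refutedBy_initSeg (α τ : Baire) {n k m : ℕ} {w : List ℕ}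
    (hk : Nat.pair n (Encodable.encode w) < k) (hm : Encodable.encode w < m) :
    RefutedBy (initSeg α k) (initSeg τ m) n w ↔ FollowsUpTo τ w ∧ Detects α n w := by
  have hα : ∀ i, (initSeg α k).getD (Nat.pair n (Encodable.encode (w.take i))) 0 =
      α (Nat.pair n (Encodable.encode (w.take i))) := fun i =>
    getD_initSeg α ((pair_right_monotone n (encode_take_le w i)).trans_lt hk)
  have hτ : ∀ i, (initSeg τ m).getD (Encodable.encode (w.take i)) 0 =
      τ (Encodable.encode (w.take i)) := fun i =>
    getD_initSeg τ ((encode_take_le w i).trans_lt hm)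
  rw [RefutedBy, getD_initSeg α hk]
  simp only [hα, hτ]
  unfold FollowsUpTo Detects
  grind

/-- The only quantifier is bounded by the length of `w`; the implication is handled as a
disjunction. -/
theorem primrecPred_refutedBy :
    PrimrecPred fun a : (List ℕ × List ℕ) × ℕ × List ℕ =>
      RefutedBy a.1.1 a.1.2 a.2.1 a.2.2 := by
  have hl : Primrec fun a : (List ℕ × List ℕ) × ℕ × List ℕ => a.1.1 := .comp .fst .fst
  have hv : Primrec fun a : (List ℕ × List ℕ) × ℕ × List ℕ => a.1.2 := .comp .snd .fst
  have hn : Primrec fun a : (List ℕ × List ℕ) × ℕ × List ℕ => a.2.1 := .comp .fst .snd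
  have hw : Primrec fun a : (List ℕ × List ℕ) × ℕ × List ℕ => a.2.2 := .comp .snd .snd
  have hc : Primrec fun b : ℕ × (List ℕ × List ℕ) × ℕ × List ℕ =>
      Encodable.encode (b.2.2.2.take b.1) :=
    Primrec.encode.comp (Primrec.list_take.comp .fst (hw.comp .snd))
  have hzero : PrimrecPred fun b : ℕ × (List ℕ × List ℕ) × ℕ × List ℕ =>
      b.2.1.1.getD (Nat.pair b.2.2.1 (Encodable.encode (b.2.2.2.take b.1))) 0 = 0 :=
    Primrec.eq.comp ((Primrec.list_getD 0).comp (hl.comp .snd)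
      (Primrec₂.natPair.comp (hn.comp .snd) hc)) (.const 0)
  have hodd : PrimrecPred fun b : ℕ × (List ℕ × List ℕ) × ℕ × List ℕ => b.1 % 2 = 1 :=
    Primrec.eq.comp (Primrec.nat_mod.comp .fst (.const 2)) (.const 1)
  have hmove : PrimrecPred fun b : ℕ × (List ℕ × List ℕ) × ℕ × List ℕ =>
      b.2.2.2.getD b.1 0 = b.2.1.2.getD (Encodable.encode (b.2.2.2.take b.1)) 0 :=
    Primrec.eq.comp ((Primrec.list_getD 0).comp (hw.comp .snd) .fst)
      ((Primrec.list_getD 0).comp (hv.comp .snd) hc)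
  have hstep := (hzero.and (hodd.not.or hmove)).primrecRel.forall_mem_list
  have htwo : PrimrecPred fun a : (List ℕ × List ℕ) × ℕ × List ℕ =>
      2 ≤ a.1.1.getD (Nat.pair a.2.1 (Encodable.encode a.2.2)) 0 :=
    Primrec.nat_le.comp (.const 2) ((Primrec.list_getD 0).comp hl
      (Primrec₂.natPair.comp hn (Primrec.encode.comp hw)))
  refine (htwo.and (hstep.comp (Primrec.list_range.comp
    (Primrec.list_length.comp hw)) .id)).of_eq fun a => ?_
  simp only [RefutedBy, imp_iff_not_or, id, List.mem_range]

/-- The value at `⟨⟨n, w⟩, v⟩` of the code of the set of losing strategies, computed from an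
initial segment `l` of a code of the game. -/
def losingValue (l : List ℕ) (c : ℕ) : ℕ :=
  if (listOfCode c.unpair.2).length ≤ c.unpair.1.unpair.2 then 0
  else if RefutedBy l (listOfCode c.unpair.2) c.unpair.1.unpair.1
    (listOfCode c.unpair.1.unpair.2) then 2 else 1

/-- A code of the set of strategies of Player 2 that do not win the open game coded by `α`. -/
def losingCode (α : Baire) : Baire := fun c => losingValue (initSeg α (c + 1)) c

theorem primrec_losingValue : Primrec₂ losingValue := by
  have hv : Primrec fun a : List ℕ × ℕ => listOfCode a.2.unpair.2 :=
    primrec_listOfCode.comp (Primrec.snd.comp (Primrec.unpair.comp .snd))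
  have hnw : Primrec fun a : List ℕ × ℕ => a.2.unpair.1.unpair :=
    Primrec.unpair.comp (Primrec.fst.comp (Primrec.unpair.comp .snd))
  have hn : Primrec fun a : List ℕ × ℕ => a.2.unpair.1.unpair.1 := .comp .fst hnw
  have hw : Primrec fun a : List ℕ × ℕ => a.2.unpair.1.unpair.2 := .comp .snd hnw
  exact Primrec.ite (Primrec.nat_le.comp (Primrec.list_length.comp hv) hw) (.const 0)
    (Primrec.ite (primrecPred_refutedBy.comp
      ((Primrec.fst.pair hv).pair (hn.pair (primrec_listOfCode.comp hw)))) (.const 2) (.const 1))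

theorem oracleComputable_losingCode : OracleComputable losingCode :=
  .of_initSeg primrec_losingValue

/-- Entry 0 postpones the answer until the segment of `τ` is longer than the code of `w`; then 2
codes the output 1 (refuted) and 1 codes the output 0. -/
theorem losingCode_apply (α τ : Baire) (n : ℕ) (w : List ℕ) (m : ℕ) :
    losingCode α (Nat.pair (Nat.pair n (Encodable.encode w)) (Encodable.encode (initSeg τ m))) =
      open Classical in if m ≤ Encodable.encode w then 0
        else if FollowsUpTo τ w ∧ Detects α n w then 2 else 1 := by
  simp only [losingCode, losingValue, Nat.unpair_pair, listOfCode_encode, initSeg_length]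
  split_ifs with hm h1 h2 h2 <;> try rfl
  all_goals
    -- The segment of `α` is long enough because `Nat.pair n (Encodable.encode w)` is the left
    -- component of the argument, hence at most the argument.
    rw [refutedBy_initSeg α τ (Nat.lt_succ_of_le (Nat.left_le_pair _ _)) (by omega)] at h1
    contradiction

/-- The `N`-th output tests the single candidate `N = ⟨n, w⟩`. Every test terminates, so the output
sequence is defined even when `τ` wins, and it is nonzero somewhere iff some candidate refutes `τ`.
-/
theorem realizesFun_losingCode {α : Baire} {f : Baire → Prop}
    (hα : RealizesFun (X := baireSpace) (Y := sierpinski) (kleeneApp α) f) :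
    RealizesFun (X := baireSpace) (Y := sierpinski) (kleeneApp (losingCode α))
      fun τ => τ ∉ {τ | Wins2 {x | f x} τ} := by
  classical
  rintro τ _ rfl
  have hcode : ∀ N m, losingCode α (Nat.pair N (Encodable.encode (initSeg τ m))) =
      if m ≤ N.unpair.2 then 0
      else if FollowsUpTo τ (listOfCode N.unpair.2) ∧
        Detects α N.unpair.1 (listOfCode N.unpair.2) then 2 else 1 := fun N m => by
    have h := losingCode_apply α τ N.unpair.1 (listOfCode N.unpair.2) m
    rw [encode_listOfCode, Nat.pair_unpair] at h
    convert h
  have hdom : ∀ N, ∃ m, losingCode α (Nat.pair N (Encodable.encode (initSeg τ m))) ≠ 0 :=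
    fun N => ⟨N.unpair.2 + 1, by rw [hcode, if_neg (by omega)]; split_ifs <;> omega⟩
  refine ⟨_, ⟨hdom, rfl⟩, ?_⟩
  change ¬ Wins2 {x | f x} τ ↔ ∃ N, losingCode α
    (Nat.pair N (Encodable.encode (initSeg τ (Nat.find (hdom N))))) - 1 ≠ 0
  have hvalue : ∀ N, losingCode α
      (Nat.pair N (Encodable.encode (initSeg τ (Nat.find (hdom N))))) - 1 ≠ 0 ↔
      FollowsUpTo τ (listOfCode N.unpair.2) ∧
        Detects α N.unpair.1 (listOfCode N.unpair.2) := fun N => by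
    have hs := Nat.find_spec (hdom N)
    rw [hcode] at hs ⊢
    split_ifs at hs ⊢ with h1 h2 <;> simp_all
  simp only [hvalue]
  rw [not_wins2_iff hα]
  constructor
  · rintro ⟨n, w, h⟩
    exact ⟨Nat.pair n (Encodable.encode w), by simpa using h⟩
  · rintro ⟨N, h⟩
    exact ⟨_, _, h⟩

theorem oracleComputable_oddPart : OracleComputable oddPart :=
  OracleComputable.oracle.comp (.of_primrec
    (Primrec.succ.comp (Primrec.nat_mul.comp (Primrec.const 2) Primrec.id)))

theorem findWSPi_le_closedChoice : WeihrauchLE FindWSPi (closedChoice baireSpace) := by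
  -- Here `oddPart` serves as the second projection of `bairePair`: the chosen point is already the
  -- strategy.
  refine ⟨fun r => Part.some (oddPart r), fun p => Part.some (losingCode p),
    oracleComputable_oddPart.baireComputable, oracleComputable_losingCode.baireComputable,
    fun G hG p W hp hW => ?_⟩
  have hβ := realizesFun_losingCode hp
  let A : (closedSpace baireSpace).carrier :=
    ⟨{τ | Wins2 (openSpace.toSet W) τ}, kleeneApp (losingCode p), kleeneApp_continuous _, hβ⟩
  obtain ⟨τ, hτG, y, hy, rfl⟩ := hG (losingCode p) A hβ (FindWSPi.nonempty W hW)
  refine ⟨oddPart (bairePair p τ), ?_, τ, hy, ?_⟩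
  · simp only [Part.bind_some, Part.mem_bind_iff, Part.mem_some_iff]
    exact ⟨τ, hτG, rfl⟩
  · exact funext fun n => bairePair_odd p τ n

theorem proposition6 : WeihrauchEquiv FindWSPi (closedChoice baireSpace) :=
  ⟨findWSPi_le_closedChoice, closedChoice_le_findWSPi⟩
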